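/- Let $n\ge 1$ and let $\mathbf b=(b_1,\dots,b_n)$ be a vector of positive integers. A $\mathbf b$-parking function is a sequence $(\beta_1,\dots,\beta_n)$ of positive integers whose nondecreasing rearrangement $\beta'_1\le\cdots\le\beta'_n$ satisfies $\beta'_i\le b_1+\cdots+b_i$ for all $1\le i\le n$. Let $\mathfrak X_n(\mathbf b)\subseteq\mathbb R^n$ be the convex hull of all $\mathbf b$-parking functions. The combinatorial diameter of a polytope is the diameter of its edge graph, that is, the maximum over all pairs of vertices of the length of a shortest path along edges between them. **Theorem.** If $b_1>1$, then the combinatorial diameter of $\mathfrak X_n(\mathbf b)$ is exactly $\min\{2n,\ \tfrac12 n(n-1)+1\}$. If $b_1=1$, then it is exactly $\min\{2(n-1),\ \tfrac12 n(n-1)\}$. -/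

import Mathlib

/-- `β` is a `b`-parking function: a sequence of positive integers whose nondecreasing
rearrangement `β ∘ σ` satisfies `β (σ i) ≤ b_1 + ⋯ + b_i` for every `i`
(indices are shifted to start at `0`). -/
def IsParkingFunction {n : ℕ} (b β : Fin n → ℕ) : Prop :=
  (∀ i, 0 < β i) ∧
    ∃ σ : Equiv.Perm (Fin n), Monotone (β ∘ σ) ∧ ∀ i, β (σ i) ≤ ∑ j ∈ Finset.Iic i, b j

/-- The `b`-parking-function polytope: the convex hull in `ℝⁿ` of all `b`-parking functions. -/
def parkingPolytope {n : ℕ} (b : Fin n → ℕ) : Set (Fin n → ℝ) :=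
  convexHull ℝ {x | ∃ β : Fin n → ℕ, IsParkingFunction b β ∧ x = fun i => (β i : ℝ)}

/-- The edge graph of a polytope `P`: its nodes are the vertices (extreme points) of `P`, and two
distinct vertices are adjacent when the segment joining them is a face of `P`, that is, the set of
maximizers over `P` of some linear functional. -/
def edgeGraph {n : ℕ} (P : Set (Fin n → ℝ)) : SimpleGraph (P.extremePoints ℝ) where
  Adj v w := v ≠ w ∧ IsExposed ℝ P (segment ℝ (v : Fin n → ℝ) (w : Fin n → ℝ))
  symm := ⟨fun v w h => ⟨h.1.symm, by rw [segment_symm]; exact h.2⟩⟩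
  loopless := ⟨fun _ h => h.1 rfl⟩

/-- The combinatorial diameter of a polytope: the largest distance between two vertices in its
edge graph, as an extended natural number (`⊤` if the graph were disconnected). -/
noncomputable def combinatorialDiameter {n : ℕ} (P : Set (Fin n → ℝ)) : ℕ∞ :=
  (edgeGraph P).ediam

/-! Let `s` be the sequence of partial sums of `b`. A vertex carries the `n - m` largest values of
`s` on some coordinates, in any order, and `1` on the other `m`. The polytope satisfies `1 ≤ x i`,
and the sum of any `n - a` coordinates is at most the sum of the `n - a` largest values of `s`.

Each description `vtx s σ m` of a vertex selects `n` of these inequalities, all tight there, and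
Abel summation (`sum_cumWeight_mul`) writes every linear functional as a constant plus a combination
of them. The signs of the coefficients are governed by comparisons with the neighbours under `Step`,
so a strict local maximum among these neighbours is the unique global one (`eq_vtx_of_forall_step`).
Dropping one inequality exposes the segment of a `Step`; hence the edges are exactly the steps
(`adj_iff_step`).

For the upper bound there are two routes between vertices: collapse everything to the all-ones point
and rebuild, or restore all values and sort by at most `n(n-1)/2` exchanges. The shorter one is
always within the claimed bound (`edist_le_of_le`). For the lower bound, the potential `weakAscents`
must climb from `0` at the decreasing arrangement to `n(n-1)/2` at an increasing one. An exchange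
gains at most `1`, a collapse at most the current number of ones, a restoration nothing
(`walk_bound`). If `b_1 = 1`, ranks collapsed up to `0` and up to `1` give the same vertex, which
accounts for the second formula. -/

/-- The value at rank `k` of a vertex whose lowest `m` ranks have been collapsed to `1`. -/
noncomputable def level {n : ℕ} (s : Fin n → ℝ) (m : ℕ) (k : Fin n) : ℝ :=
  if m ≤ (k : ℕ) then s k else 1

/-- The point whose coordinate `i` of rank `σ i` has value `s (σ i)` if the rank is at least `m`,
and `1` otherwise. -/
noncomputable def vtx {n : ℕ} (s : Fin n → ℝ) (σ : Equiv.Perm (Fin n)) (m : ℕ) : Fin n → ℝ :=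
  fun i => level s m (σ i)

/-- A convex set squeezed between the points `vtx s σ m` and the inequalities they satisfy. -/
structure IsPartialPermHull {n : ℕ} (s : Fin n → ℝ) (P : Set (Fin n → ℝ)) : Prop where
  strictMono : StrictMono s
  one_le_value : ∀ k, 1 ≤ s k
  convex : Convex ℝ P
  vtx_mem : ∀ σ m, vtx s σ m ∈ P
  one_le : ∀ x ∈ P, ∀ i, 1 ≤ x i
  tail_le : ∀ x ∈ P, ∀ (σ : Equiv.Perm (Fin n)) (a : ℕ),
    ∑ k with a ≤ (k : Fin n).val, x (σ k) ≤ ∑ k with a ≤ (k : Fin n).val, s k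
  extreme : ∀ x ∈ P.extremePoints ℝ, ∃ σ m, m ≤ n ∧ x = vtx s σ m

/-- Moves between vertices: exchanging two consecutive ranks, collapsing the lowest rank that is
not yet collapsed, and the inverse of the latter. -/
inductive Step {n : ℕ} (s : Fin n → ℝ) : (Fin n → ℝ) → (Fin n → ℝ) → Prop
  | swap (σ : Equiv.Perm (Fin n)) (m : ℕ) (k k' : Fin n) (hk : k'.val = k.val + 1)
      (hm : m ≤ k.val) : Step s (vtx s σ m) (vtx s (σ.trans (Equiv.swap k k')) m)
  | del (σ : Equiv.Perm (Fin n)) (k : Fin n) (hk : 1 < s k) :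
      Step s (vtx s σ k) (vtx s σ (k + 1))
  | add (σ : Equiv.Perm (Fin n)) (k : Fin n) (hk : 1 < s k) :
      Step s (vtx s σ (k + 1)) (vtx s σ k)

/-! ### Vertices and the displacement along a step -/

section vtx

variable {n : ℕ} {s : Fin n → ℝ}

theorem level_of_le {m : ℕ} {k : Fin n} (h : m ≤ k.val) : level s m k = s k := if_pos h

theorem level_of_lt {m : ℕ} {k : Fin n} (h : k.val < m) : level s m k = 1 :=
  if_neg (not_le.2 h)

theorem vtx_swap (σ : Equiv.Perm (Fin n)) (m : ℕ) (k k' : Fin n) (hkk : k ≠ k') :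
    vtx s (σ.trans (Equiv.swap k k')) m = vtx s σ m + (level s m k' - level s m k) •
      (Pi.single (σ.symm k) 1 - Pi.single (σ.symm k') 1 : Fin n → ℝ) := by
  ext i
  have e1 : i = σ.symm k ↔ σ i = k := Equiv.eq_symm_apply σ
  have e2 : i = σ.symm k' ↔ σ i = k' := Equiv.eq_symm_apply σ
  simp only [vtx, Equiv.trans_apply, Pi.add_apply, Pi.smul_apply, Pi.sub_apply, Pi.single_apply,
    e1, e2, smul_eq_mul]
  by_cases h : σ i = k
  · simp [h, hkk]
  · by_cases h' : σ i = k'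
    · simp [h', hkk.symm]
    · simp [h, h', Equiv.swap_apply_of_ne_of_ne h h']

theorem vtx_succ (σ : Equiv.Perm (Fin n)) (k : Fin n) :
    vtx s σ (k + 1) = vtx s σ k - (s k - 1) • (Pi.single (σ.symm k) 1 : Fin n → ℝ) := by
  ext i
  have e1 : i = σ.symm k ↔ σ i = k := Equiv.eq_symm_apply σ
  simp only [vtx, level, Pi.smul_apply, Pi.sub_apply, Pi.single_apply, e1, smul_eq_mul]
  by_cases h : σ i = k
  · simp [h]
  · have : (σ i).val ≠ k.val := fun h' => h (Fin.ext h')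
    have e : k.val + 1 ≤ (σ i).val ↔ k.val ≤ (σ i).val := by omega
    simp [h, e]

theorem vtx_zero_eq_one (hs : ∀ k : Fin n, k.val = 0 → s k = 1) (σ : Equiv.Perm (Fin n)) :
    vtx s σ 0 = vtx s σ 1 := by
  ext i
  simp only [vtx, level]
  by_cases h : (σ i).val = 0
  · simp [h, hs _ h]
  · simp [Nat.one_le_iff_ne_zero, h]

theorem vtx_congr {σ τ : Equiv.Perm (Fin n)} {m : ℕ}
    (h : ∀ k : Fin n, m ≤ k.val → σ.symm k = τ.symm k) : vtx s σ m = vtx s τ m := by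
  ext i
  simp only [vtx, level]
  by_cases h1 : m ≤ (σ i).val
  · have := h _ h1
    rw [Equiv.symm_apply_apply, Equiv.eq_symm_apply] at this
    rw [this]
  · by_cases h2 : m ≤ (τ i).val
    · have := h _ h2
      rw [Equiv.symm_apply_apply, Equiv.symm_apply_eq] at this
      rw [this] at h2
      exact absurd h2 h1
    · simp [h1, h2]

theorem level_lt_level_iff (hs : StrictMono s) (h1 : ∀ k, 1 ≤ s k) {m : ℕ} {a b : Fin n} :
    level s m a < level s m b ↔ a < b ∧ m ≤ b.val := by
  constructor
  · intro h
    by_cases hb : m ≤ b.val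
    · refine ⟨?_, hb⟩
      rw [level_of_le hb] at h
      by_contra hab
      rw [level_of_le (hb.trans (not_lt.1 hab))] at h
      exact absurd h (not_lt.2 (hs.monotone (not_lt.1 hab)))
    · rw [level_of_lt (not_le.1 hb)] at h
      have : 1 ≤ level s m a := by
        unfold level
        split_ifs
        exacts [h1 a, le_rfl]
      linarith
  · rintro ⟨hab, hb⟩
    rw [level_of_le hb]
    unfold level
    split_ifs
    · exact hs hab
    · exact (h1 a).trans_lt (hs hab)

theorem Step.ne (hs : StrictMono s) (h1 : ∀ k, 1 ≤ s k) {v w : Fin n → ℝ} (h : Step s v w) :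
    v ≠ w := by
  cases h with
  | swap σ m k k' hk hm =>
    intro h
    have := congrFun h (σ.symm k)
    simp only [vtx, Equiv.trans_apply, Equiv.apply_symm_apply, Equiv.swap_apply_left] at this
    exact this.not_lt ((level_lt_level_iff hs h1).2 ⟨Fin.lt_def.2 (by omega), by omega⟩)
  | del σ k hk =>
    intro h
    have := congrFun h (σ.symm k)
    simp [vtx, level] at this
    linarith
  | add σ k hk =>
    intro h
    have := congrFun h (σ.symm k)
    simp [vtx, level] at this
    linarith

end vtx

/-! ### Abel summation: functionals as combinations of the defining inequalities -/

section functional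

variable {n : ℕ}

/-- Weights that are `-c` below `m` and cumulative sums of `c` from `m` on. -/
noncomputable def cumWeight (c : Fin n → ℝ) (m : ℕ) (k : Fin n) : ℝ :=
  if k.val < m then -c k else ∑ j with m ≤ (j : Fin n).val ∧ j ≤ k, c j

/-- The slack of the inequality `1 ≤ y k` below `m`, of the tail inequality at `k` from `m` on. -/
noncomputable def slack (s y : Fin n → ℝ) (m : ℕ) (k : Fin n) : ℝ :=
  if k.val < m then y k - 1 else ∑ j with k.val ≤ (j : Fin n).val, (s j - y j)

/-- Exchanging the order of summation over pairs `m ≤ j ≤ k` turns cumulative weights into tail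
sums. -/
theorem sum_cumWeight_mul (s y c : Fin n → ℝ) (m : ℕ) :
    ∑ k, cumWeight c m k * (level s m k - y k) = ∑ k, c k * slack s y m k := by
  have split (f : Fin n → ℝ) :
      ∑ k, f k = ∑ k with k.val < m, f k + ∑ k with ¬ k.val < m, f k :=
    (Finset.sum_filter_add_sum_filter_not _ _ _).symm
  rw [split, split fun k => c k * slack s y m k]
  congr 1
  · refine Finset.sum_congr rfl fun k hk => ?_
    have hk : k.val < m := (Finset.mem_filter.1 hk).2
    simp only [cumWeight, slack, if_pos hk, level_of_lt hk]
    ring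
  · have h1 : ∀ k ∈ Finset.univ.filter (fun k : Fin n => ¬ k.val < m),
        cumWeight c m k * (level s m k - y k) =
          ∑ j with m ≤ (j : Fin n).val ∧ j ≤ k, c j * (s k - y k) := by
      intro k hk
      have hk : ¬ k.val < m := (Finset.mem_filter.1 hk).2
      rw [cumWeight, if_neg hk, level_of_le (not_lt.1 hk), Finset.sum_mul]
    have h2 : ∀ k ∈ Finset.univ.filter (fun k : Fin n => ¬ k.val < m),
        c k * slack s y m k = ∑ j with k.val ≤ (j : Fin n).val, c k * (s j - y j) := by
      intro k hk
      rw [slack, if_neg (Finset.mem_filter.1 hk).2, Finset.mul_sum]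
    rw [Finset.sum_congr rfl h1, Finset.sum_congr rfl h2]
    refine Finset.sum_comm' fun k j => ?_
    simp only [Finset.mem_filter, Finset.mem_univ, true_and, Fin.le_def]
    omega

/-- Taking successive differences inverts `cumWeight`, so any weights `L` can be tested for
nonnegative coefficients. -/
theorem cumWeight_difference (L : Fin n → ℝ) (m : ℕ) (k : Fin n) :
    cumWeight (fun j => if j.val < m then -L j else if j.val = m then L j else
      L j - L ⟨j.val - 1, by omega⟩) m k = L k := by
  obtain ⟨k, hk⟩ := k
  induction k with
  | zero =>
    unfold cumWeight
    by_cases h : 0 < m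
    · simp [h]
    · obtain rfl : m = 0 := by omega
      have : Finset.univ.filter (fun j : Fin n => 0 ≤ j.val ∧ j ≤ ⟨0, hk⟩) = {⟨0, hk⟩} := by
        ext j
        simp [Fin.le_def, Fin.ext_iff]
      rw [if_neg h, this, Finset.sum_singleton, if_neg h, if_pos rfl]
  | succ k ih =>
    have ih := ih (by omega)
    unfold cumWeight at ih ⊢
    by_cases h : k + 1 < m
    · simp [h]
    · rw [if_neg h]
      by_cases h' : k + 1 = m
      · have : Finset.univ.filter (fun j : Fin n => m ≤ j.val ∧ j ≤ ⟨k + 1, hk⟩) =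
            {⟨k + 1, hk⟩} := by
          ext j
          simp only [Finset.mem_filter, Finset.mem_univ, true_and, Fin.le_def,
            Finset.mem_singleton, Fin.ext_iff]
          omega
        rw [this, Finset.sum_singleton, if_neg h, if_pos h']
      · have : Finset.univ.filter (fun j : Fin n => m ≤ j.val ∧ j ≤ ⟨k + 1, hk⟩) =
            insert ⟨k + 1, hk⟩
              (Finset.univ.filter fun j : Fin n => m ≤ j.val ∧ j ≤ ⟨k, by omega⟩) := by
          ext j
          simp only [Finset.mem_filter, Finset.mem_univ, true_and, Fin.le_def,
            Finset.mem_insert, Fin.ext_iff]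
          omega
        rw [if_neg (show ¬ k < m by omega)] at ih
        rw [this, Finset.sum_insert (by simp [Fin.le_def]), ih]
        simp [h, h']

theorem tail_eq_add (f : Fin n → ℝ) (k : Fin n) :
    ∑ j with k.val ≤ (j : Fin n).val, f j = f k + ∑ j with k.val + 1 ≤ (j : Fin n).val, f j := by
  have : Finset.univ.filter (fun j : Fin n => k.val ≤ j.val) =
      insert k (Finset.univ.filter fun j : Fin n => k.val + 1 ≤ j.val) := by
    ext j
    simp only [Finset.mem_filter, Finset.mem_univ, true_and, Finset.mem_insert, Fin.ext_iff]
    omega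
  rw [this, Finset.sum_insert (by simp)]

/-- The linear functional with weight `L k` on the coordinate of rank `k`. -/
noncomputable def rankFunctional (σ : Equiv.Perm (Fin n)) (L : Fin n → ℝ) :
    StrongDual ℝ (Fin n → ℝ) :=
  ∑ k, L k • ContinuousLinearMap.proj (R := ℝ) (φ := fun _ : Fin n => ℝ) (σ.symm k)

theorem rankFunctional_apply (σ : Equiv.Perm (Fin n)) (L x : Fin n → ℝ) :
    rankFunctional σ L x = ∑ k, L k * x (σ.symm k) := by
  simp [rankFunctional]

theorem eq_rankFunctional (σ : Equiv.Perm (Fin n)) (l : StrongDual ℝ (Fin n → ℝ)) :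
    l = rankFunctional σ fun k => l (Pi.single (σ.symm k) 1) := by
  ext x
  have h (i : Fin n) : l (Pi.single i (x i)) = l (Pi.single i 1) * x i := by
    rw [show (Pi.single i (x i) : Fin n → ℝ) = x i • Pi.single i 1 by simp [← Pi.single_smul],
      map_smul, smul_eq_mul, mul_comm]
  conv_lhs => rw [← Finset.univ_sum_single x, map_sum]
  simp_rw [rankFunctional_apply, h]
  exact (Equiv.sum_comp σ.symm fun i => l (Pi.single i 1) * x i).symm

end functional

namespace IsPartialPermHull

variable {n : ℕ} {s : Fin n → ℝ} {P : Set (Fin n → ℝ)}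

theorem slack_nonneg (hP : IsPartialPermHull s P) {x : Fin n → ℝ} (hx : x ∈ P)
    (σ : Equiv.Perm (Fin n)) (m : ℕ) (k : Fin n) : 0 ≤ slack s (fun k => x (σ.symm k)) m k := by
  unfold slack
  split_ifs
  · linarith [hP.one_le x hx (σ.symm k)]
  · rw [Finset.sum_sub_distrib]
    linarith [hP.tail_le x hx σ.symm k]

theorem rankFunctional_vtx_sub (s : Fin n → ℝ) (σ : Equiv.Perm (Fin n)) (m : ℕ)
    (c x : Fin n → ℝ) :
    rankFunctional σ (cumWeight c m) (vtx s σ m) - rankFunctional σ (cumWeight c m) x =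
      ∑ k, c k * slack s (fun k => x (σ.symm k)) m k := by
  rw [← sum_cumWeight_mul, rankFunctional_apply, rankFunctional_apply, ← Finset.sum_sub_distrib]
  refine Finset.sum_congr rfl fun k _ => ?_
  simp [vtx, mul_sub]

theorem rankFunctional_le (hP : IsPartialPermHull s P) {c : Fin n → ℝ} (hc : ∀ k, 0 ≤ c k)
    (σ : Equiv.Perm (Fin n)) (m : ℕ) {x : Fin n → ℝ} (hx : x ∈ P) :
    rankFunctional σ (cumWeight c m) x ≤ rankFunctional σ (cumWeight c m) (vtx s σ m) := by
  have := Finset.sum_nonneg fun k (_ : k ∈ Finset.univ) =>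
    mul_nonneg (hc k) (hP.slack_nonneg hx σ m k)
  linarith [rankFunctional_vtx_sub s σ m c x]

theorem slack_eq_zero (hP : IsPartialPermHull s P) {c : Fin n → ℝ} (hc : ∀ k, 0 ≤ c k)
    {σ : Equiv.Perm (Fin n)} {m : ℕ} {x : Fin n → ℝ} (hx : x ∈ P)
    (h : rankFunctional σ (cumWeight c m) (vtx s σ m) ≤ rankFunctional σ (cumWeight c m) x)
    {k : Fin n} (hk : 0 < c k) : slack s (fun k => x (σ.symm k)) m k = 0 := by
  have h0 : ∀ k ∈ Finset.univ, 0 ≤ c k * slack s (fun k => x (σ.symm k)) m k := fun k _ =>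
    mul_nonneg (hc k) (hP.slack_nonneg hx σ m k)
  have h1 : ∑ k, c k * slack s (fun k => x (σ.symm k)) m k = 0 :=
    le_antisymm (by linarith [rankFunctional_vtx_sub s σ m c x]) (Finset.sum_nonneg h0)
  have := (Finset.sum_eq_zero_iff_of_nonneg h0).1 h1 k (Finset.mem_univ k)
  exact (mul_eq_zero.1 this).resolve_left hk.ne'

end IsPartialPermHull

/-! ### Optimality at a vertex and the edges of the polytope -/

namespace IsPartialPermHull

variable {n : ℕ} {s : Fin n → ℝ} {P : Set (Fin n → ℝ)}

theorem one_lt_of_pos (hP : IsPartialPermHull s P) {k : Fin n} (hk : 0 < k.val) : 1 < s k :=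
  (hP.one_le_value ⟨0, by omega⟩).trans_lt (hP.strictMono (Fin.lt_def.2 hk))

theorem tail_succ_eq_zero {y : Fin n → ℝ} {m : ℕ} {k : Fin n} (hk : m ≤ k.val)
    (h : ∀ k' : Fin n, k'.val = k.val + 1 → slack s y m k' = 0) :
    ∑ j with k.val + 1 ≤ (j : Fin n).val, (s j - y j) = 0 := by
  by_cases hn : k.val + 1 < n
  · have := h ⟨k.val + 1, hn⟩ rfl
    rwa [slack, if_neg (by simp; omega)] at this
  · refine Finset.sum_eq_zero fun j hj => ?_
    have := (Finset.mem_filter.1 hj).2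
    omega

theorem eq_level_of_slack {y : Fin n → ℝ} {m : ℕ} {k : Fin n} (h0 : slack s y m k = 0)
    (h : m ≤ k.val → ∀ k' : Fin n, k'.val = k.val + 1 → slack s y m k' = 0) :
    y k = level s m k := by
  by_cases hk : m ≤ k.val
  · have h1 := tail_succ_eq_zero hk (h hk)
    rw [slack, if_neg (not_lt.2 hk), tail_eq_add, h1] at h0
    rw [level_of_le hk]
    linarith
  · rw [slack, if_pos (not_le.1 hk)] at h0
    rw [level_of_lt (not_le.1 hk)]
    linarith

theorem eq_vtx_of_forall {σ : Equiv.Perm (Fin n)} {m : ℕ} {x : Fin n → ℝ}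
    (h : ∀ k, x (σ.symm k) = level s m k) : x = vtx s σ m := by
  ext i
  simpa [vtx] using h (σ i)

/-- The hypotheses make every coefficient of the inequalities positive, except perhaps the one at
rank `m`. A positive coefficient forces its inequality to be tight at a maximizer, and the tight
inequalities determine the coordinates one by one. -/
theorem eq_vtx_of_weights (hP : IsPartialPermHull s P) {σ : Equiv.Perm (Fin n)} {m : ℕ}
    {L x : Fin n → ℝ} (hneg : ∀ k : Fin n, k.val < m → L k < 0)
    (hlt : ∀ k k' : Fin n, k'.val = k.val + 1 → m ≤ k.val → L k < L k')
    (hbase : ∀ k : Fin n, k.val = m → 0 ≤ L k ∧ (0 < L k ∨ s k = 1)) (hx : x ∈ P)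
    (h : rankFunctional σ L (vtx s σ m) ≤ rankFunctional σ L x) : x = vtx s σ m := by
  set c : Fin n → ℝ := fun j => if j.val < m then -L j else if j.val = m then L j else
    L j - L ⟨j.val - 1, by omega⟩ with hc
  have hL : L = cumWeight c m := (funext (cumWeight_difference L m)).symm
  have hpos : ∀ k : Fin n, k.val ≠ m → 0 < c k := by
    intro k hk
    simp only [hc, if_neg hk]
    split_ifs with h1
    · linarith [hneg k h1]
    · have := hlt ⟨k.val - 1, by omega⟩ k (by simp; omega) (by simp; omega)
      linarith
  have hbase' : ∀ k : Fin n, k.val = m → c k = L k := fun k hk => by simp [hc, hk]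
  have hc0 : ∀ k, 0 ≤ c k := by
    intro k
    by_cases hk : k.val = m
    · rw [hbase' k hk]
      exact (hbase k hk).1
    · exact (hpos k hk).le
  rw [hL] at h
  have hs : ∀ k : Fin n, k.val ≠ m → slack s (fun k => x (σ.symm k)) m k = 0 := fun k hk =>
    hP.slack_eq_zero hc0 hx h (hpos k hk)
  refine eq_vtx_of_forall fun k => ?_
  refine eq_level_of_slack (y := fun k => x (σ.symm k)) ?_ fun hk k' hk' => hs k' (by omega)
  by_cases hk : k.val = m
  · rcases (hbase k hk).2 with h1 | h1
    · exact hP.slack_eq_zero hc0 hx h (by rwa [hbase' k hk])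
    -- Here the coefficient may vanish, but `s k = 1` squeezes the coordinate between `1` and the
    -- tail bound.
    · have h0 := hP.slack_nonneg hx σ m k
      have h2 := tail_succ_eq_zero (s := s) (y := fun k => x (σ.symm k)) hk.ge
        fun k' hk' => hs k' (by omega)
      have h3 := hP.one_le x hx (σ.symm k)
      rw [slack, if_neg hk.not_lt, tail_eq_add, h2] at h0 ⊢
      linarith
  · exact hs k hk

/-- A vertex that is a strict local maximum of a linear functional is its only maximum. -/
theorem eq_vtx_of_forall_step (hP : IsPartialPermHull s P) {σ : Equiv.Perm (Fin n)} {m : ℕ}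
    (hm : m ≤ n) {l : StrongDual ℝ (Fin n → ℝ)}
    (hl : ∀ w, Step s (vtx s σ m) w → l w < l (vtx s σ m)) {x : Fin n → ℝ} (hx : x ∈ P)
    (h : l (vtx s σ m) ≤ l x) : x = vtx s σ m := by
  have swap_lt : ∀ m', vtx s σ m = vtx s σ m' → ∀ k k' : Fin n, k'.val = k.val + 1 → m' ≤ k.val →
      l (Pi.single (σ.symm k) 1) < l (Pi.single (σ.symm k') 1) := by
    intro m' e k k' hk hk'
    have := hl _ (e ▸ Step.swap σ m' k k' hk hk')
    have hlt : k < k' := Fin.lt_def.2 (by omega)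
    rw [e, vtx_swap _ _ _ _ hlt.ne, level_of_le hk', level_of_le (by omega), map_add, map_smul,
      map_sub, smul_eq_mul] at this
    have h1 := hP.strictMono hlt
    by_contra h2
    have := mul_nonneg (sub_nonneg.2 h1.le) (sub_nonneg.2 (not_lt.1 h2))
    linarith
  have del_pos : ∀ k : Fin n, vtx s σ m = vtx s σ k → 1 < s k →
      0 < l (Pi.single (σ.symm k) 1) := by
    intro k e hk
    have := hl _ (e ▸ Step.del σ k hk)
    rw [e, vtx_succ, map_sub, map_smul, smul_eq_mul] at this
    exact pos_of_mul_pos_right (a := s k - 1) (by linarith) (by linarith)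
  -- If the smallest value is `1`, collapsing rank `0` changes nothing and its weight has no forced
  -- sign. A negative weight is handled by describing the vertex at level `1`, a nonnegative one at
  -- level `0`.
  have hzero : vtx s σ m = vtx s σ 0 → x = vtx s σ m := by
    intro e
    rw [e] at h ⊢
    by_cases hs : ∃ k : Fin n, k.val = 0 ∧ s k = 1 ∧ l (Pi.single (σ.symm k) 1) < 0
    · obtain ⟨k, hk, hs, hlk⟩ := hs
      have hk0 : ∀ j : Fin n, j.val = 0 → j = k := fun j hj => Fin.ext (hj.trans hk.symm)
      have e' : vtx s σ 0 = vtx s σ 1 := vtx_zero_eq_one (fun j hj => hk0 j hj ▸ hs) σ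
      rw [e'] at h ⊢
      rw [eq_rankFunctional σ l] at h
      refine hP.eq_vtx_of_weights ?_ (swap_lt 1 (e.trans e')) ?_ hx h
      · intro j hj
        rwa [hk0 j (by omega)]
      · intro j hj
        have := del_pos j (by rw [hj, e, e']) (hP.one_lt_of_pos (by omega))
        exact ⟨this.le, .inl this⟩
    · rw [eq_rankFunctional σ l] at h
      refine hP.eq_vtx_of_weights (by simp) (swap_lt 0 e) ?_ hx h
      intro j hj
      rcases (hP.one_le_value j).eq_or_lt with h1 | h1
      · exact ⟨not_lt.1 fun h2 => hs ⟨j, hj, h1.symm, h2⟩, .inr h1.symm⟩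
      · have := del_pos j (by rw [hj, e]) h1
        exact ⟨this.le, .inl this⟩
  obtain _ | m := m
  · exact hzero rfl
  rcases (hP.one_le_value ⟨m, hm⟩).eq_or_lt with h1 | h1
  · obtain rfl : m = 0 := by
      by_contra h2
      exact (hP.one_lt_of_pos (k := ⟨m, hm⟩) (Nat.pos_of_ne_zero h2)).ne h1
    exact hzero (vtx_zero_eq_one (fun k hk => by rw [h1]; congr 1; exact Fin.ext hk) σ).symm
  · rw [eq_rankFunctional σ l] at h
    refine hP.eq_vtx_of_weights ?_ (swap_lt _ rfl) ?_ hx h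
    · intro j hj
      -- Ranks below `m + 1` are all collapsed, so they may be permuted freely. The coordinate of
      -- rank `j` can thus be the one restored, and the resulting drop of `l` makes its weight
      -- negative.
      have e : vtx s σ (m + 1) = vtx s (σ.trans (Equiv.swap j ⟨m, hm⟩)) (m + 1) := by
        refine vtx_congr fun k hk => ?_
        rw [Equiv.symm_trans_apply, Equiv.symm_swap, Equiv.swap_apply_of_ne_of_ne] <;>
          (rintro rfl; first | omega | exact absurd hk (Nat.not_succ_le_self m))
      have := hl (vtx s (σ.trans (Equiv.swap j ⟨m, hm⟩)) m)
        (by rw [e]; exact Step.add _ ⟨m, hm⟩ h1)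
      have e2 := vtx_succ (s := s) (σ.trans (Equiv.swap j ⟨m, hm⟩)) ⟨m, hm⟩
      rw [Equiv.symm_trans_apply, Equiv.symm_swap, Equiv.swap_apply_right, eq_sub_iff_add_eq,
        ← e] at e2
      rw [← e2, map_add, map_smul, smul_eq_mul] at this
      by_contra h2
      have := mul_nonneg (sub_nonneg.2 h1.le) (not_lt.1 h2)
      linarith
    · intro j hj
      have := del_pos j (by rw [hj]) (hP.one_lt_of_pos (by omega))
      exact ⟨this.le, .inl this⟩

theorem vtx_mem_extremePoints (hP : IsPartialPermHull s P) (σ : Equiv.Perm (Fin n)) (m : ℕ) :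
    vtx s σ m ∈ P.extremePoints ℝ := by
  refine exposedPoints_subset_extremePoints
    ⟨hP.vtx_mem σ m, rankFunctional σ (cumWeight (fun _ => 1) m), fun x hx => ?_⟩
  have h0 : ∀ k : Fin n, (0 : ℝ) ≤ (fun _ => 1 : Fin n → ℝ) k := fun _ => zero_le_one
  refine ⟨hP.rankFunctional_le h0 σ m hx, fun h => eq_vtx_of_forall fun k => ?_⟩
  have h1 := fun k => hP.slack_eq_zero h0 hx h (k := k) zero_lt_one
  exact eq_level_of_slack (y := fun k => x (σ.symm k)) (h1 k) fun _ k' _ => h1 k'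

theorem isExposed_segment (hP : IsPartialPermHull s P) {v w : Fin n → ℝ} (hv : v ∈ P)
    (hw : w ∈ P) (l : StrongDual ℝ (Fin n → ℝ)) (hl : ∀ x ∈ P, l x ≤ l v) (hvw : l w = l v)
    (h : ∀ x ∈ P, l v ≤ l x → x ∈ segment ℝ v w) : IsExposed ℝ P (segment ℝ v w) := by
  refine fun _ => ⟨l, Set.ext fun x => ⟨fun hx => ⟨hP.convex.segment_subset hv hw hx, ?_⟩,
    fun hx => h x hx.1 (hx.2 v hv)⟩⟩
  obtain ⟨a, b, ha, hb, hab, rfl⟩ := hx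
  intro y hy
  rw [map_add, map_smul, map_smul, hvw, ← add_smul, hab, one_smul]
  exact hl y hy

/-- Giving only the tail inequality at `k'` coefficient zero leaves a face on which all coordinates
but two are fixed and those two have constant sum. The tail inequalities for both arrangements bound
each of the two by `s k'`, which cuts out the segment. -/
theorem isExposed_of_swap (hP : IsPartialPermHull s P) (σ : Equiv.Perm (Fin n)) (m : ℕ)
    (k k' : Fin n) (hk : k'.val = k.val + 1) (hm : m ≤ k.val) :
    IsExposed ℝ P
      (segment ℝ (vtx s σ m) (vtx s (σ.trans (Equiv.swap k k')) m)) := by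
  have hlt : k < k' := Fin.lt_def.2 (by omega)
  have hs := hP.strictMono hlt
  set c : Fin n → ℝ := fun j => if j = k' then 0 else 1 with hc
  have hc0 : ∀ j, 0 ≤ c j := fun j => by simp only [hc]; split_ifs <;> norm_num
  have hw : cumWeight c m k' = cumWeight c m k := by
    have : Finset.univ.filter (fun j : Fin n => m ≤ j.val ∧ j ≤ k') =
        insert k' (Finset.univ.filter fun j : Fin n => m ≤ j.val ∧ j ≤ k) := by
      ext j
      simp only [Finset.mem_filter, Finset.mem_univ, true_and, Fin.le_def,
        Finset.mem_insert, Fin.ext_iff]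
      omega
    rw [cumWeight, cumWeight, if_neg (by omega), if_neg (by omega), this,
      Finset.sum_insert (by simp [hlt])]
    simp [hc]
  have hswap := vtx_swap (s := s) σ m k k' hlt.ne
  rw [level_of_le hm, level_of_le (by omega)] at hswap
  refine hP.isExposed_segment (hP.vtx_mem _ _) (hP.vtx_mem _ _)
    (rankFunctional σ (cumWeight c m)) (fun x hx => hP.rankFunctional_le hc0 σ m hx) ?_ ?_
  · have h1 (a : Fin n) : rankFunctional σ (cumWeight c m) (Pi.single (σ.symm a) 1) =
        cumWeight c m a := by
      rw [rankFunctional_apply, Finset.sum_eq_single a]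
      · simp
      · intro b _ hb
        simp [hb]
      · simp
    rw [hswap, map_add, map_smul, map_sub, h1, h1, hw]
    simp
  · intro x hx h
    have hsl : ∀ j, j ≠ k' → slack s (fun k => x (σ.symm k)) m j = 0 := fun j hj =>
      hP.slack_eq_zero hc0 hx h (by simp [hc, hj])
    have hval : ∀ j, j ≠ k → j ≠ k' → x (σ.symm j) = level s m j := fun j hj hj' =>
      eq_level_of_slack (y := fun k => x (σ.symm k)) (hsl j hj') fun _ i hi => hsl i fun h =>
        hj (Fin.ext (by rw [h] at hi; omega))
    have htail : ∑ j with k'.val + 1 ≤ (j : Fin n).val, (s j - x (σ.symm j)) = 0 :=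
      tail_succ_eq_zero (s := s) (y := fun k => x (σ.symm k)) (k := k') (m := m) (by omega)
        fun j hj => hsl j fun h => by rw [h] at hj; omega
    have h1 := hsl k hlt.ne
    rw [slack, if_neg (by omega), tail_eq_add, ← hk, tail_eq_add, htail] at h1
    have h2 := hP.slack_nonneg hx σ m k'
    rw [slack, if_neg (by omega), tail_eq_add, htail] at h2
    have h3 := hP.slack_nonneg hx (σ.trans (Equiv.swap k k')) m k'
    have h4 : ∑ j with k'.val + 1 ≤ (j : Fin n).val,
        (s j - x ((σ.trans (Equiv.swap k k')).symm j)) = 0 := by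
      rw [← htail]
      refine Finset.sum_congr rfl fun j hj => ?_
      have := (Finset.mem_filter.1 hj).2
      rw [Equiv.symm_trans_apply, Equiv.symm_swap, Equiv.swap_apply_of_ne_of_ne] <;>
        rintro rfl <;> omega
    rw [slack, if_neg (by omega), tail_eq_add, h4, Equiv.symm_trans_apply, Equiv.symm_swap,
      Equiv.swap_apply_right] at h3
    have hd : 0 < s k' - s k := by linarith
    rw [segment_eq_image']
    refine ⟨(x (σ.symm k) - s k) / (s k' - s k), ⟨div_nonneg (by linarith) hd.le,
      (div_le_one hd).2 (by linarith)⟩, ?_⟩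
    rw [hswap, add_sub_cancel_left]
    ext i
    obtain ⟨j, rfl⟩ := σ.symm.surjective i
    simp only [vtx, Pi.add_apply, Pi.smul_apply, Pi.sub_apply, Pi.single_apply, smul_eq_mul,
      Equiv.apply_symm_apply, σ.symm.injective.eq_iff]
    by_cases hj : j = k
    · subst hj
      rw [if_pos rfl, if_neg hlt.ne, level_of_le hm]
      field_simp
      ring
    · by_cases hj' : j = k'
      · subst hj'
        rw [if_pos rfl, if_neg hlt.ne', level_of_le (by omega)]
        field_simp
        linarith
      · rw [if_neg hj, if_neg hj', hval j hj hj']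
        ring

/-- Dropping the inequality at `k` frees one coordinate, which then ranges between `1` and `s k`. -/
theorem isExposed_of_del (hP : IsPartialPermHull s P) (σ : Equiv.Perm (Fin n)) (k : Fin n)
    (hk : 1 < s k) : IsExposed ℝ P (segment ℝ (vtx s σ k) (vtx s σ (k + 1))) := by
  set c : Fin n → ℝ := fun j => if j = k then 0 else 1 with hc
  have hc0 : ∀ j, 0 ≤ c j := fun j => by simp only [hc]; split_ifs <;> norm_num
  have hdel := vtx_succ (s := s) σ k
  refine hP.isExposed_segment (hP.vtx_mem _ _) (hP.vtx_mem _ _)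
    (rankFunctional σ (cumWeight c k)) (fun x hx => hP.rankFunctional_le hc0 σ k hx) ?_ ?_
  · have h1 : rankFunctional σ (cumWeight c k) (Pi.single (σ.symm k) 1) = 0 := by
      rw [rankFunctional_apply, Finset.sum_eq_single k]
      · have : Finset.univ.filter (fun j : Fin n => k.val ≤ j.val ∧ j ≤ k) = {k} := by
          ext j
          simp only [Finset.mem_filter, Finset.mem_univ, true_and, Fin.le_def,
            Finset.mem_singleton, Fin.ext_iff]
          omega
        simp only [cumWeight, this]
        simp [hc]
      · intro b _ hb
        simp [hb]
      · simp
    rw [hdel, map_sub, map_smul, h1]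
    simp
  · intro x hx h
    have hsl : ∀ j, j ≠ k → slack s (fun k => x (σ.symm k)) k j = 0 := fun j hj =>
      hP.slack_eq_zero hc0 hx h (by simp [hc, hj])
    have hval : ∀ j, j ≠ k → x (σ.symm j) = level s k j := fun j hj =>
      eq_level_of_slack (y := fun k => x (σ.symm k)) (hsl j hj) fun _ i hi => hsl i fun h => by
        rw [h] at hi
        omega
    have htail := tail_succ_eq_zero (s := s) (y := fun k => x (σ.symm k)) (k := k) le_rfl
        fun j hj => hsl j fun h => by rw [h] at hj; omega
    have h2 := hP.slack_nonneg hx σ k k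
    rw [slack, if_neg (by omega), tail_eq_add, htail] at h2
    have h3 := hP.one_le x hx (σ.symm k)
    have hd : 0 < s k - 1 := by linarith
    rw [segment_eq_image']
    refine ⟨(s k - x (σ.symm k)) / (s k - 1), ⟨div_nonneg (by linarith) hd.le,
      (div_le_one hd).2 (by linarith)⟩, ?_⟩
    rw [hdel, sub_sub_cancel_left]
    ext i
    obtain ⟨j, rfl⟩ := σ.symm.surjective i
    simp only [vtx, Pi.add_apply, Pi.smul_apply, Pi.neg_apply, Pi.single_apply, smul_eq_mul,
      Equiv.apply_symm_apply, σ.symm.injective.eq_iff]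
    by_cases hj : j = k
    · subst hj
      rw [if_pos rfl, level_of_le le_rfl]
      field_simp
      ring
    · rw [if_neg hj, hval j hj]
      ring

theorem isExposed_of_step (hP : IsPartialPermHull s P) {v w : Fin n → ℝ} (h : Step s v w) :
    IsExposed ℝ P (segment ℝ v w) := by
  cases h with
  | swap σ m k k' hk hm => exact hP.isExposed_of_swap σ m k k' hk hm
  | del σ k hk => exact hP.isExposed_of_del σ k hk
  | add σ k hk =>
    rw [segment_symm]
    exact hP.isExposed_of_del σ k hk

theorem step_mem_extremePoints (hP : IsPartialPermHull s P) {v w : Fin n → ℝ} (h : Step s v w) :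
    w ∈ P.extremePoints ℝ := by
  cases h <;> exact hP.vtx_mem_extremePoints _ _

/-- If the edge `v w` is exposed by `l` and is not a step, no step neighbour of `v` maximizes `l`:
it would be an extreme point on the segment, hence `v` or `w`. Then `v` is a strict local maximum,
so the only maximum, contradicting `w`. -/
theorem adj_iff_step (hP : IsPartialPermHull s P) {v w : P.extremePoints ℝ} :
    (edgeGraph P).Adj v w ↔ Step s (v : Fin n → ℝ) w := by
  refine ⟨fun ⟨hne, hex⟩ => ?_, fun h => ⟨fun e => h.ne hP.strictMono hP.one_le_value
    (congrArg _ e), hP.isExposed_of_step h⟩⟩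
  obtain ⟨v, hv⟩ := v
  obtain ⟨w, hw⟩ := w
  simp only at hex ⊢
  have hne : w ≠ v := fun h => hne (Subtype.ext h.symm)
  obtain ⟨l, hl⟩ := hex ⟨v, left_mem_segment ℝ v w⟩
  have hvl : v ∈ segment ℝ v w := left_mem_segment ℝ v w
  have hwl : w ∈ segment ℝ v w := right_mem_segment ℝ v w
  rw [hl] at hvl hwl
  obtain ⟨σ, m, hm, rfl⟩ := hP.extreme v hv
  by_contra hstep
  refine hne (hP.eq_vtx_of_forall_step hm (fun u hu => ?_) hwl.1 (hwl.2 _ hvl.1))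
  by_contra hu'
  have hue := hP.step_mem_extremePoints hu
  have hseg : u ∈ segment ℝ (vtx s σ m) w := by
    rw [hl]
    exact ⟨hue.1, fun y hy => (hvl.2 y hy).trans (not_lt.1 hu')⟩
  rcases (mem_extremePoints_iff_forall_segment.1 hue).2 _ hvl.1 _ hwl.1 hseg with e | e
  · exact hu.ne hP.strictMono hP.one_le_value e
  · exact hstep (e ▸ hu)

end IsPartialPermHull

/-! ### The potential `weakAscents` and its change along a step -/

section counting

variable {n : ℕ} {s : Fin n → ℝ}

/-- The number of pairs of coordinates that are not strictly decreasing. -/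
noncomputable def weakAscents (v : Fin n → ℝ) : ℕ :=
  (Finset.univ.filter fun p : Fin n × Fin n => p.1 < p.2 ∧ v p.1 ≤ v p.2).card

/-- The number of coordinates equal to `1`. -/
noncomputable def onesCount (v : Fin n → ℝ) : ℕ :=
  (Finset.univ.filter fun i => v i = 1).card

theorem onesCount_vtx (σ : Equiv.Perm (Fin n)) (m : ℕ) :
    onesCount (vtx s σ m) = onesCount (level s m) := by
  unfold onesCount
  refine Finset.card_equiv σ fun i => ?_
  rw [Finset.mem_filter, Finset.mem_filter]
  simp [vtx]

theorem onesCount_level_succ {k : Fin n} (hk : 1 < s k) :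
    onesCount (level s (k + 1)) = onesCount (level s k) + 1 := by
  have : Finset.univ.filter (fun i => level s (k + 1) i = 1) =
      insert k (Finset.univ.filter fun i => level s k i = 1) := by
    ext i
    simp only [Finset.mem_filter, Finset.mem_univ, true_and, Finset.mem_insert]
    by_cases hi : i = k
    · simp [hi, level]
    · have h : i.val ≠ k.val := fun h => hi (Fin.ext h)
      have e : k.val + 1 ≤ i.val ↔ k.val ≤ i.val := by omega
      simp only [hi, level, e, false_or]
  rw [onesCount, this, Finset.card_insert_of_notMem]
  · rfl
  · simp [level, hk.ne']

theorem le_onesCount_level (k : Fin n) : k.val ≤ onesCount (level s k) := by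
  have : Finset.Iio k ⊆ Finset.univ.filter fun i => level s k i = 1 := fun i hi => by
    simp only [Finset.mem_filter, Finset.mem_univ, true_and]
    exact level_of_lt (Fin.lt_def.1 (Finset.mem_Iio.1 hi))
  simpa [onesCount] using Finset.card_le_card this

theorem vtx_le_vtx_iff (hs : StrictMono s) (h1 : ∀ k, 1 ≤ s k) (σ : Equiv.Perm (Fin n)) (m : ℕ)
    (i j : Fin n) : vtx s σ m i ≤ vtx s σ m j ↔ ¬ (σ j < σ i ∧ m ≤ (σ i).val) := by
  rw [← level_lt_level_iff hs h1, not_lt]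
  rfl

/-- Consecutive ranks compare alike with every other rank, so only the pair formed by the two
exchanged coordinates can become a weak ascent. -/
theorem weakAscents_swap_le (hs : StrictMono s) (h1 : ∀ k, 1 ≤ s k) (σ : Equiv.Perm (Fin n))
    (m : ℕ) (k k' : Fin n) (hk : k'.val = k.val + 1) (hm : m ≤ k.val) :
    weakAscents (vtx s (σ.trans (Equiv.swap k k')) m) ≤ weakAscents (vtx s σ m) + 1 := by
  set a := σ.symm k
  set a' := σ.symm k'
  have hsub : Finset.univ.filter (fun p : Fin n × Fin n => p.1 < p.2 ∧
      vtx s (σ.trans (Equiv.swap k k')) m p.1 ≤ vtx s (σ.trans (Equiv.swap k k')) m p.2) ⊆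
      insert (min a a', max a a') (Finset.univ.filter fun p : Fin n × Fin n => p.1 < p.2 ∧
        vtx s σ m p.1 ≤ vtx s σ m p.2) := by
    rintro ⟨i, j⟩ h
    simp only [Finset.mem_filter, Finset.mem_univ, true_and, Finset.mem_insert,
      vtx_le_vtx_iff hs h1, Equiv.trans_apply, Prod.mk.injEq] at h ⊢
    obtain ⟨hij, h⟩ := h
    by_contra! hcon
    obtain ⟨hne, h2⟩ := hcon
    obtain ⟨h3, h4⟩ := h2 hij
    apply h
    have key : ¬ (σ i = k' ∧ σ j = k) := by
      rintro ⟨e1, e2⟩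
      rw [← Equiv.eq_symm_apply] at e1 e2
      rw [e1, e2] at hij
      exact hne (by rw [e1, min_eq_right hij.le]) (by rw [e2, max_eq_left hij.le])
    have hdich (r : Fin n) : (Equiv.swap k k' r).val =
        if r.val = k.val then k'.val else if r.val = k'.val then k.val else r.val := by
      simp only [← Fin.ext_iff, Equiv.swap_apply_def]
      split_ifs <;> rfl
    simp only [Fin.ext_iff, Fin.lt_def] at key h3 ⊢
    rw [hdich, hdich]
    split_ifs <;> omega
  exact (Finset.card_le_card hsub).trans (Finset.card_insert_le _ _)

/-- A new weak ascent must pair the collapsed coordinate with one of the `k` coordinates of lower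
rank. -/
theorem weakAscents_succ_le (hs : StrictMono s) (h1 : ∀ k, 1 ≤ s k) (σ : Equiv.Perm (Fin n))
    (k : Fin n) : weakAscents (vtx s σ (k + 1)) ≤ weakAscents (vtx s σ k) + k.val := by
  have hsub : Finset.univ.filter (fun p : Fin n × Fin n => p.1 < p.2 ∧
      vtx s σ (k + 1) p.1 ≤ vtx s σ (k + 1) p.2) ⊆
      (Finset.univ.filter fun p : Fin n × Fin n => p.1 < p.2 ∧ vtx s σ k p.1 ≤ vtx s σ k p.2) ∪
        (Finset.Iio k).image fun r => (σ.symm k, σ.symm r) := by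
    rintro ⟨i, j⟩ h
    simp only [Finset.mem_filter, Finset.mem_univ, true_and, Finset.mem_union, Finset.mem_image,
      vtx_le_vtx_iff hs h1, Finset.mem_Iio, Prod.mk.injEq] at h ⊢
    obtain ⟨hij, h⟩ := h
    by_cases h2 : σ j < σ i ∧ k.val ≤ (σ i).val
    · have e : σ i = k := Fin.ext (by
        by_contra h3
        exact h ⟨h2.1, by omega⟩)
      exact .inr ⟨σ j, e ▸ h2.1, by rw [← e, σ.symm_apply_apply], σ.symm_apply_apply j⟩
    · exact .inl ⟨hij, h2⟩
  refine ((Finset.card_le_card hsub).trans (Finset.card_union_le _ _)).trans ?_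
  exact Nat.add_le_add_left (Finset.card_image_le.trans (by simp)) _

/-- Since ties are counted, restoring a value can only break ties and never creates a weak ascent.
-/
theorem weakAscents_le_succ (hs : StrictMono s) (h1 : ∀ k, 1 ≤ s k) (σ : Equiv.Perm (Fin n))
    (k : ℕ) : weakAscents (vtx s σ k) ≤ weakAscents (vtx s σ (k + 1)) := by
  refine Finset.card_le_card fun p hp => ?_
  simp only [Finset.mem_filter, Finset.mem_univ, true_and, vtx_le_vtx_iff hs h1] at hp ⊢
  exact ⟨hp.1, fun h => hp.2 ⟨h.1, by omega⟩⟩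

theorem Step.weakAscents_le (hs : StrictMono s) (h1 : ∀ k, 1 ≤ s k) {v w : Fin n → ℝ}
    (h : Step s v w) :
    (weakAscents w ≤ weakAscents v + 1 ∧ onesCount w = onesCount v) ∨
    (weakAscents w ≤ weakAscents v + onesCount v ∧ onesCount w = onesCount v + 1) ∨
    (weakAscents w ≤ weakAscents v ∧ onesCount w + 1 = onesCount v) := by
  cases h with
  | swap σ m k k' hk hm =>
    exact .inl ⟨weakAscents_swap_le hs h1 σ m k k' hk hm, by rw [onesCount_vtx, onesCount_vtx]⟩
  | del σ k hk =>
    refine .inr (.inl ⟨(weakAscents_succ_le hs h1 σ k).trans ?_, ?_⟩)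
    · rw [onesCount_vtx]
      exact Nat.add_le_add_left (le_onesCount_level k) _
    · rw [onesCount_vtx, onesCount_vtx, onesCount_level_succ hk]
  | add σ k hk =>
    refine .inr (.inr ⟨weakAscents_le_succ hs h1 σ k, ?_⟩)
    rw [onesCount_vtx, onesCount_vtx, onesCount_level_succ hk]

theorem weakAscents_reverse (hs : StrictMono s) (h1 : ∀ k, 1 ≤ s k) :
    weakAscents (vtx s Fin.revPerm 0) = 0 := by
  rw [weakAscents, Finset.card_eq_zero, Finset.filter_eq_empty_iff]
  rintro ⟨i, j⟩ _ ⟨hij, h⟩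
  rw [vtx_le_vtx_iff hs h1] at h
  exact h ⟨by simpa using hij, Nat.zero_le _⟩

theorem weakAscents_one (hs : StrictMono s) (h1 : ∀ k, 1 ≤ s k) (m : ℕ) :
    weakAscents (vtx s 1 m) = ∑ i ∈ Finset.range n, i := by
  have : Finset.univ.filter (fun p : Fin n × Fin n => p.1 < p.2 ∧
      vtx s 1 m p.1 ≤ vtx s 1 m p.2) = Finset.univ.filter fun p => p.1 < p.2 := by
    ext ⟨i, j⟩
    simp only [Finset.mem_filter, Finset.mem_univ, true_and, vtx_le_vtx_iff hs h1,
      Equiv.Perm.one_apply]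
    exact ⟨fun h => h.1, fun h => ⟨h, fun h' => lt_asymm h h'.1⟩⟩
  rw [weakAscents, this, Finset.card_filter, ← Finset.univ_product_univ, Finset.sum_product_right,
    ← Fin.sum_univ_eq_sum_range fun i => i]
  refine Finset.sum_congr rfl fun j _ => ?_
  rw [← Finset.card_filter, show Finset.univ.filter (fun i => i < j) = Finset.Iio j by ext; simp,
    Fin.card_Iio]

end counting

/-! ### Estimates for walks and explicit paths -/

namespace IsPartialPermHull

variable {n : ℕ} {s : Fin n → ℝ} {P : Set (Fin n → ℝ)}

/-- `S`, `D`, `A` count exchanges, collapses and restorations. Restorations only lower the number of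
ones, so the collapse preceded by `i` others meets at most `onesCount v + i` ones. -/
theorem walk_bound (hP : IsPartialPermHull s P) {v w : P.extremePoints ℝ}
    (p : (edgeGraph P).Walk v w) : ∃ S D A : ℕ, S + D + A = p.length ∧
      onesCount w.1 + A = onesCount v.1 + D ∧
      weakAscents w.1 ≤ weakAscents v.1 + S + ∑ i ∈ Finset.range D, (onesCount v.1 + i) := by
  induction p with
  | nil => exact ⟨0, 0, 0, by simp⟩
  | @cons u v w h p ih =>
    obtain ⟨S, D, A, e1, e2, e3⟩ := ih
    rw [SimpleGraph.Walk.length_cons]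
    rcases (hP.adj_iff_step.1 h).weakAscents_le hP.strictMono hP.one_le_value with
      ⟨h1, h2⟩ | ⟨h1, h2⟩ | ⟨h1, h2⟩
    · rw [h2] at e2 e3
      exact ⟨S + 1, D, A, by omega, by omega, by omega⟩
    · refine ⟨S, D + 1, A, by omega, by omega, ?_⟩
      have : ∑ i ∈ Finset.range D, (onesCount v.1 + i) =
          ∑ i ∈ Finset.range D, (onesCount u.1 + (i + 1)) :=
        Finset.sum_congr rfl fun i _ => by omega
      rw [Finset.sum_range_succ', ← this]
      omega
    · refine ⟨S, D, A + 1, by omega, by omega, ?_⟩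
      have : ∑ i ∈ Finset.range D, (onesCount v.1 + i) ≤
          ∑ i ∈ Finset.range D, (onesCount u.1 + i) :=
        Finset.sum_le_sum fun i _ => by omega
      omega

/-- The vertex `vtx s σ m` of the edge graph. -/
noncomputable def vertex (hP : IsPartialPermHull s P) (σ : Equiv.Perm (Fin n)) (m : ℕ) :
    P.extremePoints ℝ := ⟨vtx s σ m, hP.vtx_mem_extremePoints σ m⟩

theorem edist_le_one (hP : IsPartialPermHull s P) {v w : P.extremePoints ℝ}
    (h : Step s (v : Fin n → ℝ) w) : (edgeGraph P).edist v w ≤ 1 :=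
  (SimpleGraph.edist_eq_one_iff_adj.2 (hP.adj_iff_step.2 h)).le

theorem edist_del (hP : IsPartialPermHull s P) (σ : Equiv.Perm (Fin n)) {m d : ℕ}
    (h : m + d ≤ n) (hs : ∀ k : Fin n, m ≤ k.val → 1 < s k) :
    (edgeGraph P).edist (hP.vertex σ m) (hP.vertex σ (m + d)) ≤ d := by
  induction d with
  | zero => simp
  | succ d ih =>
    refine (SimpleGraph.edist_triangle (v := hP.vertex σ (m + d))).trans ?_
    push_cast
    exact add_le_add (ih (by omega)) (hP.edist_le_one
      (Step.del σ ⟨m + d, h⟩ (hs _ (Nat.le_add_right _ _))))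

theorem exists_move (hP : IsPartialPermHull s P) (d : ℕ) : ∀ (σ : Equiv.Perm (Fin n))
    (k r : Fin n), r.val = k.val + d → ∃ τ : Equiv.Perm (Fin n), τ.symm r = σ.symm k ∧
      (∀ j, r < j → τ.symm j = σ.symm j) ∧
      (edgeGraph P).edist (hP.vertex σ 0) (hP.vertex τ 0) ≤ d := by
  induction d with
  | zero => exact fun σ k r h => ⟨σ, by rw [Fin.ext h], fun _ _ => rfl, by simp⟩
  | succ d ih =>
    intro σ k r h
    obtain ⟨k', hk'⟩ : ∃ k' : Fin n, k'.val = k.val + 1 := ⟨⟨k.val + 1, by omega⟩, rfl⟩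
    obtain ⟨τ, h1, h2, h3⟩ := ih (σ.trans (Equiv.swap k k')) k' r (by omega)
    refine ⟨τ, ?_, fun j hj => ?_, ?_⟩
    · rw [h1, Equiv.symm_trans_apply, Equiv.symm_swap, Equiv.swap_apply_right]
    · rw [h2 j hj, Equiv.symm_trans_apply, Equiv.symm_swap, Equiv.swap_apply_of_ne_of_ne] <;>
        (rintro rfl; have := Fin.lt_def.1 hj; omega)
    · refine (SimpleGraph.edist_triangle
        (v := hP.vertex (σ.trans (Equiv.swap k k')) 0)).trans ?_
      push_cast
      rw [add_comm]
      exact add_le_add h3 (hP.edist_le_one (Step.swap σ 0 k k' hk' (Nat.zero_le _)))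

/-- Sorting from the top rank down: bringing the right coordinate to rank `r` costs at most `r`
exchanges and leaves the higher ranks untouched. -/
theorem edist_perm (hP : IsPartialPermHull s P) (r : ℕ) (hr : r ≤ n) :
    ∀ σ τ : Equiv.Perm (Fin n), (∀ k : Fin n, r ≤ k.val → σ.symm k = τ.symm k) →
      (edgeGraph P).edist (hP.vertex σ 0) (hP.vertex τ 0) ≤
        (∑ i ∈ Finset.range r, i : ℕ) := by
  induction r with
  | zero =>
    intro σ τ h
    have : σ = τ := by
      rw [← Equiv.symm_symm σ, ← Equiv.symm_symm τ]
      exact congrArg _ (Equiv.ext fun k => h k (Nat.zero_le _))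
    simp [this]
  | succ r ih =>
    intro σ τ h
    set R : Fin n := ⟨r, hr⟩ with hR
    set k := σ (τ.symm R) with hk
    have hkr : k.val ≤ r := by
      by_contra hcon
      have := h k (by omega)
      rw [hk, Equiv.symm_apply_apply, τ.symm.injective.eq_iff, ← hk] at this
      rw [← this] at hcon
      exact hcon le_rfl
    obtain ⟨ρ, h1, h2, h3⟩ := hP.exists_move (r - k.val) σ k R (by simp only [hR]; omega)
    refine (SimpleGraph.edist_triangle (v := hP.vertex ρ 0)).trans ?_
    rw [Finset.sum_range_succ, add_comm (∑ i ∈ Finset.range r, i), Nat.cast_add]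
    refine add_le_add (h3.trans (by exact_mod_cast Nat.sub_le _ _)) (ih (by omega) ρ τ ?_)
    intro j hj
    rcases hj.eq_or_lt with e | hlt
    · obtain rfl : R = j := Fin.ext e
      rw [h1, hk, Equiv.symm_apply_apply]
    · rw [h2 j (Fin.lt_def.2 hlt), h j hlt]

end IsPartialPermHull

/-! ### The two diameters -/

namespace IsPartialPermHull

variable {n : ℕ} {s : Fin n → ℝ} {P : Set (Fin n → ℝ)}

theorem vertex_eq {hP : IsPartialPermHull s P} {σ τ : Equiv.Perm (Fin n)} {m m' : ℕ}
    (h : vtx s σ m = vtx s τ m') : hP.vertex σ m = hP.vertex τ m' := Subtype.ext h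

/-- The two terms of the minimum are the routes through the all-ones point and through the
uncollapsed arrangements. The lowest `c` ranks have nothing to collapse, so they cost nothing on the
second route. -/
theorem edist_le_of_le (hP : IsPartialPermHull s P) {c : ℕ}
    (hc : ∀ k : Fin n, c ≤ k.val → 1 < s k) (h0 : ∀ σ, vtx s σ c = vtx s σ 0)
    (σ τ : Equiv.Perm (Fin n)) {m m' : ℕ} (hm : c ≤ m) (hm' : c ≤ m') (hn : m ≤ n)
    (hn' : m' ≤ n) :
    (edgeGraph P).edist (hP.vertex σ m) (hP.vertex τ m') ≤
      (min (n - m + (n - m')) (m - c + ∑ i ∈ Finset.range n, i + (m' - c)) : ℕ) := by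
  have down (ρ : Equiv.Perm (Fin n)) {a b : ℕ} (hca : c ≤ a) (hab : a ≤ b) (hbn : b ≤ n) :
      (edgeGraph P).edist (hP.vertex ρ a) (hP.vertex ρ b) ≤ ((b - a : ℕ) : ℕ∞) := by
    obtain ⟨d, rfl⟩ := Nat.exists_eq_add_of_le hab
    rw [Nat.add_sub_cancel_left]
    exact hP.edist_del ρ hbn fun k hk => hc k (hca.trans hk)
  rw [(Nat.mono_cast (α := ℕ∞)).map_min]
  refine le_min ?_ ?_
  · have e : hP.vertex σ n = hP.vertex τ n := vertex_eq (vtx_congr fun k hk => by omega)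
    refine (SimpleGraph.edist_triangle (v := hP.vertex σ n)).trans ?_
    rw [Nat.cast_add]
    refine add_le_add (down σ hm hn le_rfl) ?_
    rw [e, SimpleGraph.edist_comm]
    exact down τ hm' hn' le_rfl
  · refine (SimpleGraph.edist_triangle (v := hP.vertex τ c)).trans ?_
    rw [Nat.cast_add]
    refine add_le_add ((SimpleGraph.edist_triangle (v := hP.vertex σ c)).trans ?_)
      (down τ le_rfl hm' hn')
    rw [Nat.cast_add, vertex_eq (h0 σ), vertex_eq (h0 τ)]
    refine add_le_add ?_ (hP.edist_perm n le_rfl σ τ fun k hk => by omega)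
    rw [← vertex_eq (h0 σ), SimpleGraph.edist_comm]
    exact down σ le_rfl hm hn

theorem onesCount_level_zero {c : ℕ} (hcn : c ≤ n) (hc : ∀ k : Fin n, s k = 1 ↔ k.val < c) :
    onesCount (level s 0) = c := by
  have : Finset.univ.filter (fun k => level s 0 k = 1) =
      Finset.univ.filter fun k : Fin n => k.val < c := by
    ext k
    rw [Finset.mem_filter, Finset.mem_filter, ← hc k, level_of_le (Nat.zero_le _)]
  rw [onesCount, this, Fin.card_filter_val_lt, min_eq_right hcn]

/-- The test pair is the decreasing arrangement and the increasing one collapsed up to `m`. All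
pairs of the latter are weak ascents whatever `m` is, which leaves `m` free to adjust the balance of
ones. -/
theorem le_combinatorialDiameter (hP : IsPartialPermHull s P) {c m N : ℕ} (hcn : c ≤ n)
    (hc : ∀ k : Fin n, s k = 1 ↔ k.val < c)
    (hN : ∀ S D A : ℕ, onesCount (vtx s 1 m) + A = c + D →
      ∑ i ∈ Finset.range n, i ≤ S + (D * c + ∑ i ∈ Finset.range D, i) → N ≤ S + D + A) :
    (N : ℕ∞) ≤ combinatorialDiameter P := by
  refine le_trans ?_ (SimpleGraph.edist_le_ediam (u := hP.vertex Fin.revPerm 0)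
    (v := hP.vertex 1 m))
  refine le_iInf fun p => ?_
  obtain ⟨S, D, A, h1, h2, h3⟩ := hP.walk_bound p
  simp only [vertex, weakAscents_reverse hP.strictMono hP.one_le_value,
    weakAscents_one hP.strictMono hP.one_le_value, zero_add] at h2 h3
  rw [onesCount_vtx Fin.revPerm, onesCount_level_zero hcn hc] at h2 h3
  rw [Finset.sum_add_distrib, Finset.sum_const, Finset.card_range, smul_eq_mul] at h3
  rw [← h1]
  exact_mod_cast hN S D A h2 h3

theorem diameter_of_one_lt (hP : IsPartialPermHull s P) (hn : 0 < n) (h1 : 1 < s ⟨0, hn⟩) :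
    combinatorialDiameter P = ((min (2 * n) (n * (n - 1) / 2 + 1) : ℕ) : ℕ∞) := by
  have hs (k : Fin n) : 1 < s k := h1.trans_le (hP.strictMono.monotone (Nat.zero_le k.val))
  have hs' (k : Fin n) : s k = 1 ↔ k.val < 0 := by simp [(hs k).ne']
  have h2 := Finset.sum_range_id_mul_two n
  rw [← Finset.sum_range_id]
  obtain ⟨a, rfl⟩ : ∃ a, n = a + 1 := ⟨n - 1, by omega⟩
  refine le_antisymm (SimpleGraph.ediam_le_of_edist_le ?_) ?_
  · rintro ⟨v, hv⟩ ⟨w, hw⟩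
    obtain ⟨σ, m, hm, rfl⟩ := hP.extreme v hv
    obtain ⟨τ, m', hm', rfl⟩ := hP.extreme w hw
    refine (hP.edist_le_of_le (c := 0) (fun k _ => hs k) (fun _ => rfl) σ τ (Nat.zero_le _)
      (Nat.zero_le _) hm hm').trans (Nat.cast_le.2 ?_)
    -- With `t = m + m'`, the routes cost `2n - t` and `n(n-1)/2 + t`. The second suffices for `t ≤
    -- 1`; for `t ≥ 2` the first is at most `2(n-1)`, and this inequality applies.
    have : 2 * a ≤ ∑ i ∈ Finset.range (a + 1), i + 1 := by
      rw [Nat.add_sub_cancel] at h2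
      rcases le_or_gt a 1 with h | h
      · interval_cases a <;> simp_all
      · obtain ⟨d, rfl⟩ := Nat.exists_eq_add_of_le h
        nlinarith
    omega
  -- The minimum is `2n` for `n ≥ 5` and `n(n-1)/2 + 1` for `n ≤ 4`. In the first range, a walk with
  -- `A < n` collapses needs at least `(n-A)(n+A-1)/2 ≥ 2(n-A)` exchanges.
  · rcases le_or_gt 4 a with ha | ha
    · refine hP.le_combinatorialDiameter (c := 0) (m := 0) (Nat.zero_le _) hs' fun S D A h3 h4 => ?_
      rw [onesCount_vtx, onesCount_level_zero (Nat.zero_le _) hs'] at h3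
      obtain rfl : A = D := by omega
      refine (min_le_left _ _).trans ?_
      by_contra hcon
      have h5 := Finset.sum_range_id_mul_two A
      obtain ⟨e, he⟩ : ∃ e, a + 1 = A + e := ⟨a + 1 - A, by omega⟩
      obtain _ | A := A
      · rw [Nat.add_sub_cancel] at h2
        simp only [Finset.range_zero, Finset.sum_empty] at h4
        nlinarith
      · rw [Nat.add_sub_cancel] at h2 h5
        obtain rfl : a = A + e := by omega
        nlinarith
    -- Ending with one coordinate collapsed forces an extra collapse, the source of the `+ 1`. For
    -- `A ≤ 3` the other `2A` moves are no fewer than the `A(A+1)/2` ascents the collapses can gain.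
    · refine hP.le_combinatorialDiameter (c := 0) (m := 1) (Nat.zero_le _) hs' fun S D A h3 h4 => ?_
      rw [onesCount_vtx, ← onesCount_level_zero (s := s) (Nat.zero_le _) hs'] at h3
      have h5 := onesCount_level_succ (k := ⟨0, hn⟩) h1
      simp only [zero_add] at h5
      rw [h5] at h3
      obtain rfl : D = A + 1 := by omega
      rcases le_or_gt 4 A with hA | hA
      · omega
      · interval_cases a <;> interval_cases A <;> simp [Finset.sum_range_succ] at h4 ⊢ <;> omega

theorem diameter_of_eq_one (hP : IsPartialPermHull s P) (hn : 0 < n) (h1 : s ⟨0, hn⟩ = 1) :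
    combinatorialDiameter P = ((min (2 * (n - 1)) (n * (n - 1) / 2) : ℕ) : ℕ∞) := by
  have hs (k : Fin n) (hk : 1 ≤ k.val) : 1 < s k := hP.one_lt_of_pos hk
  have hs' (k : Fin n) : s k = 1 ↔ k.val < 1 := by
    refine ⟨fun h => by_contra fun h' => (hs k (by omega)).ne' h, fun h => ?_⟩
    rw [← h1]
    congr 1
    exact Fin.ext (by simp; omega)
  have h01 (σ : Equiv.Perm (Fin n)) : vtx s σ 1 = vtx s σ 0 :=
    (vtx_zero_eq_one (fun k hk => (hs' k).2 (by omega)) σ).symm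
  have h2 := Finset.sum_range_id_mul_two n
  rw [← Finset.sum_range_id]
  obtain ⟨a, rfl⟩ : ∃ a, n = a + 1 := ⟨n - 1, by omega⟩
  rw [Nat.add_sub_cancel] at h2 ⊢
  refine le_antisymm (SimpleGraph.ediam_le_of_edist_le ?_) ?_
  · have normal : ∀ v ∈ P.extremePoints ℝ, ∃ σ m, 1 ≤ m ∧ m ≤ a + 1 ∧ v = vtx s σ m := by
      intro v hv
      obtain ⟨σ, m, hm, rfl⟩ := hP.extreme v hv
      obtain _ | m := m
      · exact ⟨σ, 1, le_rfl, hn, (h01 σ).symm⟩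
      · exact ⟨σ, m + 1, by omega, hm, rfl⟩
    rintro ⟨v, hv⟩ ⟨w, hw⟩
    obtain ⟨σ, m, hm1, hm, rfl⟩ := normal v hv
    obtain ⟨τ, m', hm1', hm', rfl⟩ := normal w hw
    refine (hP.edist_le_of_le (c := 1) hs h01 σ τ hm1 hm1' hm hm').trans (Nat.cast_le.2 ?_)
    have : 2 * a ≤ ∑ i ∈ Finset.range (a + 1), i + 1 := by
      rcases le_or_gt a 1 with h | h
      · interval_cases a <;> simp_all
      · obtain ⟨d, rfl⟩ := Nat.exists_eq_add_of_le h
        nlinarith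
    omega
  · refine hP.le_combinatorialDiameter (c := 1) (m := 0) hn hs' fun S D A h3 h4 => ?_
    rw [onesCount_vtx, onesCount_level_zero hn hs'] at h3
    obtain rfl : A = D := by omega
    by_contra hcon
    obtain ⟨hcon1, hcon2⟩ := lt_min_iff.1 (not_le.1 hcon)
    have h5 := Finset.sum_range_id_mul_two A
    -- At least `(a-A)(a+A+1)/2` exchanges are needed, which is at least `2(a-A)` once `a + A ≥ 3`;
    -- the remaining cases are finitely many.
    rcases le_or_gt 3 (a + A) with ha | ha
    · obtain ⟨e, rfl⟩ : ∃ e, a = A + e := ⟨a - A, by omega⟩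
      obtain _ | A := A
      · omega
      · rw [Nat.add_sub_cancel] at h5
        nlinarith
    · have hA : A < 3 := by omega
      have ha' : a < 3 := by omega
      interval_cases a <;> interval_cases A <;> simp [Finset.sum_range_succ] at * <;> omega

end IsPartialPermHull

/-! ### The parking-function polytope fits the abstract description -/

section parking

variable {n : ℕ} {b β : Fin n → ℕ}

/-- The partial sum `b_1 + ⋯ + b_k`. -/
def partialSum (b : Fin n → ℕ) (k : Fin n) : ℕ := ∑ j ∈ Finset.Iic k, b j

theorem partialSum_strictMono (hb : ∀ i, 0 < b i) : StrictMono (partialSum b) := fun i j hij =>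
  Finset.sum_lt_sum_of_subset (Finset.Iic_subset_Iic.2 hij.le) (Finset.mem_Iic.2 le_rfl)
    (by simpa using hij) (hb j) fun _ _ _ => Nat.zero_le _

theorem partialSum_pos (hb : ∀ i, 0 < b i) (k : Fin n) : 0 < partialSum b k :=
  Finset.sum_pos (fun i _ => hb i) ⟨k, Finset.mem_Iic.2 le_rfl⟩

/-- Any arrangement meeting the bounds can be replaced by the sorted one. If the sorted value at `i`
were too large, the entries at positions `≥ i` would inject through `σ` into the positions `> i`,
which are one fewer. -/
theorem isParkingFunction_of_le (hb : ∀ i, 0 < b i) (h0 : ∀ i, 0 < β i)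
    (σ : Equiv.Perm (Fin n)) (h : ∀ i, β (σ i) ≤ partialSum b i) : IsParkingFunction b β := by
  refine ⟨h0, Tuple.sort β, Tuple.monotone_sort β, fun i => ?_⟩
  by_contra hcon
  have hlt : partialSum b i < β (Tuple.sort β i) := not_le.1 hcon
  have := Finset.card_le_card_of_injOn (s := Finset.Ici i) (t := Finset.Ioi i)
    (fun j => σ.symm (Tuple.sort β j)) (fun j hj => ?_)
    ((σ.symm.injective.comp (Tuple.sort β).injective).injOn)
  · rw [Fin.card_Ici, Fin.card_Ioi] at this
    omega
  · have hj : i ≤ j := by simpa using hj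
    have h2 : β (Tuple.sort β i) ≤ β (Tuple.sort β j) := Tuple.monotone_sort β hj
    have h3 := h (σ.symm (Tuple.sort β j))
    rw [Equiv.apply_symm_apply] at h3
    simpa using (partialSum_strictMono hb).lt_iff_lt.1 ((hlt.trans_le h2).trans_le h3)

theorem sum_tail_comp_perm_le {s : Fin n → ℝ} (hs : Monotone s) (ρ : Equiv.Perm (Fin n)) (a : ℕ) :
    ∑ k with a ≤ (k : Fin n).val, s (ρ k) ≤ ∑ k with a ≤ (k : Fin n).val, s k := by
  have hf : Monotone fun k : Fin n => if a ≤ k.val then (1 : ℝ) else 0 := by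
    intro i j hij
    have : i.val ≤ j.val := hij
    dsimp only
    split_ifs
    · exact le_rfl
    · omega
    · exact zero_le_one
    · exact le_rfl
  simpa [Finset.sum_filter] using (hf.monovary hs).sum_mul_comp_perm_le_sum_mul (σ := ρ)

theorem update_isParkingFunction (hb : ∀ i, 0 < b i) (h0 : ∀ i, 0 < β i)
    (σ : Equiv.Perm (Fin n)) (h : ∀ i, β (σ i) ≤ partialSum b i) {i : Fin n} {t : ℕ} (ht : 0 < t)
    (hti : t ≤ partialSum b i) : IsParkingFunction b (Function.update β (σ i) t) := by
  refine isParkingFunction_of_le hb (fun j => ?_) σ fun j => ?_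
  · rw [Function.update_apply]
    split_ifs
    exacts [ht, h0 j]
  · rw [Function.update_apply]
    split_ifs with hj
    · rwa [σ.injective hj]
    · exact h j

/-- A coordinate strictly between `1` and its bound can be moved by `1` both ways, so the point
would be a midpoint. -/
theorem eq_partialSum_of_mem_extremePoints (hb : ∀ i, 0 < b i) (h0 : ∀ i, 0 < β i)
    (σ : Equiv.Perm (Fin n)) (h : ∀ i, β (σ i) ≤ partialSum b i)
    (hβ : (fun i => (β i : ℝ)) ∈ (parkingPolytope b).extremePoints ℝ) {i : Fin n}
    (hi : β (σ i) ≠ 1) : β (σ i) = partialSum b i := by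
  by_contra hne
  have hlt := lt_of_le_of_ne (h i) hne
  have hpos := h0 (σ i)
  have mem (t : ℕ) (ht : 0 < t) (hti : t ≤ partialSum b i) :
      (fun j => ((Function.update β (σ i) t j : ℕ) : ℝ)) ∈ parkingPolytope b :=
    subset_convexHull _ _ ⟨_, update_isParkingFunction hb h0 σ h ht hti, rfl⟩
  have hmid : (fun i => (β i : ℝ)) ∈ openSegment ℝ
      (fun j => ((Function.update β (σ i) (β (σ i) - 1) j : ℕ) : ℝ))
      (fun j => ((Function.update β (σ i) (β (σ i) + 1) j : ℕ) : ℝ)) := by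
    refine ⟨1 / 2, 1 / 2, by norm_num, by norm_num, by norm_num, ?_⟩
    ext j
    simp only [Pi.add_apply, Pi.smul_apply, smul_eq_mul, Function.update_apply]
    split_ifs with hj
    · rw [hj, Nat.cast_sub hpos]
      push_cast
      ring
    · ring
  have := hβ.2 (mem _ (by omega) (by omega)) (mem _ (by omega) hlt) hmid
  have := congrFun this (σ i)
  rw [Function.update_self, Nat.cast_inj] at this
  omega

theorem isPartialPermHull_parkingPolytope (hb : ∀ i, 0 < b i) :
    IsPartialPermHull (fun k => (partialSum b k : ℝ)) (parkingPolytope b) where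
  strictMono := fun i j hij => Nat.cast_lt.2 (partialSum_strictMono hb hij)
  one_le_value := fun k => by exact_mod_cast partialSum_pos hb k
  convex := convex_convexHull ℝ _
  vtx_mem := fun σ m => by
    refine subset_convexHull _ _
      ⟨fun i => if m ≤ (σ i).val then partialSum b (σ i) else 1, ?_, ?_⟩
    · refine isParkingFunction_of_le hb (fun i => ?_) σ.symm fun i => ?_
      · split_ifs
        exacts [partialSum_pos hb _, one_pos]
      · rw [Equiv.apply_symm_apply]
        split_ifs
        exacts [le_rfl, partialSum_pos hb i]
    · ext i
      simp only [vtx, level]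
      split_ifs <;> simp
  one_le := fun x hx i => by
    refine convexHull_min (t := {x | 1 ≤ x i}) ?_ (convex_halfSpace_ge
      (f := fun x : Fin n → ℝ => x i) ⟨fun _ _ => rfl, fun _ _ => rfl⟩ 1) hx
    rintro _ ⟨β, hβ, rfl⟩
    exact Nat.one_le_cast (α := ℝ).2 (hβ.1 i)
  tail_le := fun x hx σ a => by
    refine convexHull_min (t := {x | ∑ k with a ≤ (k : Fin n).val, x (σ k) ≤ _}) ?_
      (convex_halfSpace_le (f := fun x : Fin n → ℝ => ∑ k with a ≤ (k : Fin n).val, x (σ k))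
        ⟨fun _ _ => Finset.sum_add_distrib, fun _ _ => (Finset.mul_sum _ _ _).symm⟩ _) hx
    rintro _ ⟨β, ⟨-, τ, -, hτ⟩, rfl⟩
    refine le_trans (Finset.sum_le_sum fun k _ => ?_) (sum_tail_comp_perm_le
      (fun i j hij => Nat.cast_le.2 ((partialSum_strictMono hb).monotone hij))
      (σ.trans τ.symm) a)
    have := hτ (τ.symm (σ k))
    rw [Equiv.apply_symm_apply] at this
    exact Nat.cast_le.2 this
  extreme := fun x hx => by
    obtain ⟨β, ⟨h0, τ, hmono, hτ⟩, rfl⟩ := extremePoints_convexHull_subset hx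
    have hval := fun i => eq_partialSum_of_mem_extremePoints hb h0 τ hτ hx (i := i)
    -- `m` is the first sorted position whose value is not `1`; by monotonicity all later values
    -- also differ from `1`, hence attain their bounds.
    obtain ⟨m, hm, hlt, hge⟩ : ∃ m ≤ n, (∀ i : Fin n, i.val < m → β (τ i) = 1) ∧
        ∀ i : Fin n, m ≤ i.val → β (τ i) = partialSum b i := by
      by_cases hne : ∃ i, β (τ i) ≠ 1
      · obtain ⟨i, hi, hmin⟩ := wellFounded_lt.has_min {i | β (τ i) ≠ 1} hne
        refine ⟨i.val, i.isLt.le, fun j hj => not_not.1 fun h => hmin j h hj,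
          fun j hj => hval j ?_⟩
        have h1 : β (τ i) ≤ β (τ j) := hmono hj
        have h2 := h0 (τ i)
        have h3 : β (τ i) ≠ 1 := hi
        omega
      · push Not at hne
        exact ⟨n, le_rfl, fun i _ => hne i, fun i hi => by omega⟩
    refine ⟨τ.symm, m, hm, ?_⟩
    ext i
    obtain ⟨j, rfl⟩ := τ.surjective i
    simp only [vtx, Equiv.symm_apply_apply]
    rcases lt_or_ge j.val m with hj | hj
    · rw [level_of_lt hj, hlt j hj, Nat.cast_one]
    · rw [level_of_le hj, hge j hj]

end parking

theorem mainTheorem9 (n : ℕ) (hn : 0 < n) (b : Fin n → ℕ) (hb : ∀ i, 0 < b i) :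
    (1 < b ⟨0, hn⟩ →
      combinatorialDiameter (parkingPolytope b) =
        ((min (2 * n) (n * (n - 1) / 2 + 1) : ℕ) : ℕ∞)) ∧
    (b ⟨0, hn⟩ = 1 →
      combinatorialDiameter (parkingPolytope b) =
        ((min (2 * (n - 1)) (n * (n - 1) / 2) : ℕ) : ℕ∞)) := by
  have hP := isPartialPermHull_parkingPolytope hb
  have h0 : partialSum b ⟨0, hn⟩ = b ⟨0, hn⟩ := by
    have : Finset.Iic (⟨0, hn⟩ : Fin n) = {⟨0, hn⟩} := by
      ext i
      simp [Fin.le_def, Fin.ext_iff]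
    rw [partialSum, this, Finset.sum_singleton]
  exact ⟨fun h => hP.diameter_of_one_lt hn (by rw [h0]; exact_mod_cast h),
    fun h => hP.diameter_of_eq_one hn (by rw [h0, h, Nat.cast_one])⟩
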